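/- Let $U:\mathcal H_{\mathrm{in}}\to\mathcal H_{\mathrm R}\otimes\mathcal H_{\mathrm{out}}$ be a unitary operator, where $\mathcal H_{\mathrm{in}}=(\mathbb C^2)^{\otimes n_{\mathrm{in}}}$, $\mathcal H_{\mathrm{R}}=(\mathbb C^2)^{\otimes n_{\mathrm R}}$, $\mathcal H_{\mathrm{out}}=(\mathbb C^2)^{\otimes n_{\mathrm{out}}}$ (so $n_{\mathrm{in}}=n_{\mathrm R}+n_{\mathrm{out}}$), and let $\Lambda=\{\Lambda_k\}_{k\in\{0,1\}^{n_{\mathrm R}}}$ be the quantum instrument $$\Lambda_k(\rho)=\operatorname{Tr}_{\mathrm R}\big[(|k\rangle\langle k|_{\mathrm R}\otimes \mathbb I_{\mathrm{out}})\,U\rho\, U^\dagger\big].$$ **Implementability.** An instrument $\Lambda$ on $n_{\mathrm{in}}$ qubits with $n_{\mathrm{out}}\le m$ output qubits is *$m$-qubit implementable with delayed inputs* if it is realized by a finite sequence of the following operations on $m$ available qubits, which start in $|0\rangle^{\otimes m}$ (the $n_{\mathrm{in}}$ input qubits being initially unloaded), with a classical value $k$ that has a fixed initial value: (a) a unitary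 on the $m$ qubits depending on $k$; (b) a computational basis measurement of a subset $S(k)$ of the $m$ qubits, with operators $|0\rangle\langle x|_{S}\otimes\mathbb I$, $x\in\{0,1\}^{|S|}$, after which the classical value is $kx$; (c) classical processing $k\mapsto f(k)$, the unnormalized states with the same new value being summed; (d) input loading: a subset $S(k)$ of the $m$ qubits is measured, with operators $\langle x|_{S}\otimes\mathbb I$, and replaced by a set $J$ of unloaded input qubits, $|J|=|S(k)|$, where $J$ does not depend on $k$, after which the classical value is $kx$. All input qubits must have been loaded at the end, when $m-n_{\mathrm{out}}$ of the available qubits are traced out; the resulting map at final classical value $k$ is $\Lambda_k$ (there may be additional final classical values). **POVMs.** The POVM $\hat\Lambda=\{\hat\Lambda_k\}$ associated with $\Lambda$ is given by $\operatorname{Tr}[\hat\Lambda_k\rho]=\operatorname{Tr}[\Lambda_k(\rho)]$ for all $\rho$. A POVM $E=\{E_k\}$ is *composable from* a POVM $F=\{F_l\}$ if there are numbers $\nu_{k,l}\ge 0$ with $\sum_k\nu_{k,l}=1$ for all $l$ and $E_k=\sum_l\nu_{k,l}F_l$ for all $k$. A POVM $E$ on $\mathcal H_{\mathrm{in}}$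 has *no outcome signaling* from an input qubit $\mathrm A$ if there is a POVM $F$ on the remaining input qubits such that $\operatorname{Tr}[E_k\rho]=\operatorname{Tr}[F_k\operatorname{Tr}_{\mathrm A}(\rho)]$ for all $k$ and $\rho$. **Theorem.** Let $T\in\{0,1,\dots,n_{\mathrm{in}}\}$. If $\Lambda$ is $(n_{\mathrm{in}}-T)$-qubit implementable with delayed inputs, then there exist POVMs $E^{(1)},\dots,E^{(T)}$ on $\mathcal H_{\mathrm{in}}$, with outcome sets of the form $\{0,1\}^{N}$, and distinct input qubits $\mathrm A_1,\dots,\mathrm A_T$ such that 1. $E^{(t)}$ is composable from $E^{(t+1)}$ for $1\le t<T$, and (if $T\ge1$) $E^{(T)}$ is composable from $\hat\Lambda$; 2. each $E^{(t)}$ has no outcome signaling from $\mathrm A_t$; 3. every element of $E^{(t)}$ has rank at most $2^{n_{\mathrm{in}}-t}$. Consequently, if no such POVMs and qubits exist for some $T\in\{0,\dots,n_{\mathrm{in}}\}$, then $m>n_{\mathrm{in}}-T$ for every $m$ such that $\Lambda$ is $m$-qubit implementable with delayed inputs. -/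

import Mathlib

open scoped Matrix Kronecker ComplexOrder

noncomputable section

namespace QubitReduction

/-- Labels of the computational basis of the qubits indexed by `ι`, i.e. of `(ℂ²)^{⊗ι}`.
Also used for the outcome set `{0,1}^ι` of bit strings. -/
abbrev Bits (ι : Type) : Type := ι → Fin 2

/-- Linear operators on the Hilbert space `ℂ^a` with orthonormal basis labelled by `a`. -/
abbrev Op (a : Type) : Type := Matrix a a ℂ

/-- The map `ρ ↦ K ρ K†`. -/
def conj {a b : Type} [Fintype a] (K : Matrix b a ℂ) : Op a →ₗ[ℂ] Op b where
  toFun ρ := K * ρ * Kᴴ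
  map_add' ρ σ := by simp [Matrix.mul_add, Matrix.add_mul]
  map_smul' c ρ := by simp

/-- The partial trace over the first tensor factor. -/
def traceFst {a b : Type} [Fintype a] : Op (a × b) →ₗ[ℂ] Op b where
  toFun ρ := Matrix.of fun i j => ∑ x, ρ (x, i) (x, j)
  map_add' ρ σ := by ext; simp [Finset.sum_add_distrib]
  map_smul' c ρ := by ext; simp [Finset.mul_sum]

/-- Rewriting an operator in a relabelled basis (used only with bijective relabellings). -/
def relabel {a b : Type} (g : b → a) : Op a →ₗ[ℂ] Op b where
  toFun ρ := ρ.submatrix g g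
  map_add' _ _ := rfl
  map_smul' _ _ := rfl

/-! ### POVMs -/

/-- Positive operator-valued measures with outcome set `K`. -/
structure IsPOVM {a K : Type} [Fintype a] [DecidableEq a] [Fintype K] (E : K → Op a) : Prop where
  posSemidef : ∀ k, (E k).PosSemidef
  sum_eq_one : ∑ k, E k = 1

/-- The POVM associated with a family of maps `Λ k`: the operators `E k` with
`Tr[E k ρ] = Tr[Λ k ρ]` for all `ρ`. -/
def assocPOVM {a b K : Type} [Fintype b] [DecidableEq a]
    (Λ : K → Op a →ₗ[ℂ] Op b) (k : K) : Op a :=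
  Matrix.of fun i j => (Λ k (Matrix.single j i 1)).trace

theorem trace_assocPOVM_mul {a b K : Type} [Fintype a] [Fintype b] [DecidableEq a]
    (Λ : K → Op a →ₗ[ℂ] Op b) (k : K) (ρ : Op a) :
    (assocPOVM Λ k * ρ).trace = (Λ k ρ).trace := by
  have h : ∀ i j, ρ i j * (Λ k (Matrix.single i j 1)).trace
      = (Λ k (Matrix.single i j (ρ i j))).trace := by
    intro i j
    have : Matrix.single i j (ρ i j) = ρ i j • Matrix.single i j (1 : ℂ) := by
      simp [Matrix.smul_single]
    rw [this, map_smul, Matrix.trace_smul, smul_eq_mul]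
  conv_rhs => rw [Matrix.matrix_eq_sum_single ρ]
  simp only [map_sum, Matrix.trace_sum, ← h]
  rw [Finset.sum_comm]
  simp [Matrix.trace, Matrix.mul_apply, assocPOVM, mul_comm]

/-- The POVM `E` is composable from the POVM `F`: it is obtained from `F` by
classical post-processing with a column-stochastic matrix `ν`. -/
def ComposableFrom {a K L : Type} [Fintype K] [Fintype L] (E : K → Op a) (F : L → Op a) : Prop :=
  ∃ ν : K → L → ℝ, (∀ k l, 0 ≤ ν k l) ∧ (∀ l, ∑ k, ν k l = 1) ∧
    ∀ k, E k = ∑ l, (ν k l : ℂ) • F l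

/-- The partial trace over qubit `q` of an `n`-qubit system. -/
def traceQubit {n : ℕ} (q : Fin n) : Op (Bits (Fin n)) →ₗ[ℂ] Op (Bits {i : Fin n // i ≠ q}) :=
  traceFst ∘ₗ relabel (Equiv.funSplitAt q (Fin 2)).symm

/-- Outcome no-signaling of the POVM `E` from the input qubit `q`: the outcome probabilities are
those of a POVM on the other qubits. -/
def OutcomeNoSignaling {n : ℕ} {K : Type} [Fintype K] (E : K → Op (Bits (Fin n))) (q : Fin n) :
    Prop :=
  ∃ F : K → Op (Bits {i : Fin n // i ≠ q}), IsPOVM F ∧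
    ∀ k ρ, (E k * ρ).trace = (F k * traceQubit q ρ).trace

/-! ### Elementary operations with `m` available qubits and delayed inputs -/

/-- Basis labels of `H_m ⊗ H_in`: the `m` available qubits, and the input qubits in `R` that have
not been loaded yet. -/
abbrev Sys {n : ℕ} (m : ℕ) (R : Finset (Fin n)) : Type := Bits (Fin m) × Bits R

/-- A conditional family `Φ_{k' | k}` of maps, from the classical value `k` to the value `k'`. -/
abbrev CondMaps {n : ℕ} (m : ℕ) (K K' : Type) (R R' : Finset (Fin n)) : Type :=
  K → K' → Op (Sys m R) →ₗ[ℂ] Op (Sys m R')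

open Classical in
/-- `Φ_{k'|k}(ρ) = δ_{k',k} (U_k ⊗ 1) ρ (U_k ⊗ 1)†`. -/
def unitaryStep {n m : ℕ} {K : Type} (R : Finset (Fin n))
    (U : K → Op (Bits (Fin m))) : CondMaps m K K R R :=
  fun k k' => if k' = k then conj (U k ⊗ₖ (1 : Op (Bits R))) else 0

open Classical in
/-- `M_x = |0⟩⟨x|_S ⊗ 1` on the `m` available qubits. -/
def measOp {m : ℕ} (S : Finset (Fin m)) (x : Bits S) : Op (Bits (Fin m)) :=
  Matrix.of fun c c₀ =>
    if (∀ i : S, c₀ i = x i ∧ c i = 0) ∧ (∀ i ∉ S, c i = c₀ i) then 1 else 0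

open Classical in
/-- `Φ_{k'|k}(ρ) = ∑_x δ_{k',kx} (M_x ⊗ 1) ρ (M_x ⊗ 1)†`, where `S = S(k)` and the new classical
value `kx` is the pair of `k` and `x ∈ {0,1}^S`. -/
def measureStep {n m : ℕ} {K : Type} (R : Finset (Fin n)) (S : K → Finset (Fin m)) :
    CondMaps m K (Σ k, Bits (S k)) R R :=
  fun k k' => ∑ x : Bits (S k),
    if k' = ⟨k, x⟩ then conj (measOp (S k) x ⊗ₖ (1 : Op (Bits R))) else 0

open Classical in
/-- `Φ_{k'|k}(ρ) = δ_{k',f(k)} ρ`. -/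
def classicalStep {n : ℕ} (m : ℕ) {K K' : Type} (R : Finset (Fin n)) (f : K → K') :
    CondMaps m K K' R R :=
  fun k k' => if k' = f k then LinearMap.id else 0

open Classical in
/-- The operator `⟨x|_S ⊗ 1`, followed by the relabelling in which the available qubits are
those outside `S` together with the input qubits in `J`, the slot `i ∈ S` now holding the
input qubit `e i ∈ J`; the unloaded input qubits become `R \ J`. -/
def loadOp {n m : ℕ} {R J : Finset (Fin n)} (hJ : J ⊆ R) (S : Finset (Fin m)) (e : S ≃ J)
    (x : Bits S) : Matrix (Sys m (R \ J)) (Sys m R) ℂ :=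
  Matrix.of fun c c₀ =>
    if (∀ i : S, c₀.1 i = x i) ∧ (∀ i ∉ S, c.1 i = c₀.1 i) ∧
      (∀ i : S, c.1 i = c₀.2 ⟨e i, hJ (e i).2⟩) ∧
      (∀ j : ↥(R \ J), c.2 j = c₀.2 ⟨j, Finset.sdiff_subset j.2⟩) then 1 else 0

open Classical in
/-- `Φ_{k'|k}(ρ) = ∑_x δ_{k',kx} (⟨x|_S ⊗ 1) ρ (|x⟩_S ⊗ 1)`, followed by the update of the
system labels; `S = S(k)` may depend on the classical value, while `J` is fixed. -/
def loadStep {n m : ℕ} {K : Type} {R J : Finset (Fin n)} (hJ : J ⊆ R) (S : K → Finset (Fin m))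
    (e : ∀ k, S k ≃ J) : CondMaps m K (Σ k, Bits (S k)) R (R \ J) :=
  fun k k' => ∑ x : Bits (S k), if k' = ⟨k, x⟩ then conj (loadOp hJ (S k) (e k) x) else 0

/-- Execution of one more round: `∑_k Φ_{k'|k} ∘ Ξ_k`. -/
def andThen {n m : ℕ} {K K' : Type} [Fintype K] {R R' : Finset (Fin n)}
    (Ξ : K → Op (Bits (Fin n)) →ₗ[ℂ] Op (Sys m R)) (Φ : CondMaps m K K' R R') :
    K' → Op (Bits (Fin n)) →ₗ[ℂ] Op (Sys m R') :=
  fun k' => ∑ k, Φ k k' ∘ₗ Ξ k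

/-- The preparation `ρ ↦ |0…0⟩⟨0…0| ⊗ ρ` of the `m` available qubits, with all `n` input qubits
still unloaded. -/
def prepare (n m : ℕ) :
    Op (Bits (Fin n)) →ₗ[ℂ] Op (Sys m (Finset.univ : Finset (Fin n))) where
  toFun ρ := Matrix.single (0 : Bits (Fin m)) 0 (1 : ℂ) ⊗ₖ
    ρ.submatrix (fun r i => r ⟨i, Finset.mem_univ i⟩) (fun r i => r ⟨i, Finset.mem_univ i⟩)
  map_add' ρ σ := by ext; simp [Matrix.kroneckerMap_apply, mul_add]
  map_smul' c ρ := by ext; simp [Matrix.kroneckerMap_apply, mul_left_comm]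

/-- `Circuit m n R K Ξ`: some finite sequence of elementary operations on `m` available qubits,
started in `|0…0⟩` with `n` unloaded input qubits, ends with the input qubits in `R` unloaded and
a classical value in `K`, and `Ξ k` maps the input operator to the resulting (unnormalized)
operator on `H_m ⊗ H_in` at the classical value `k`. -/
inductive Circuit (m n : ℕ) : (R : Finset (Fin n)) → (K : Type) →
    (K → Op (Bits (Fin n)) →ₗ[ℂ] Op (Sys m R)) → Prop
  | start : Circuit m n Finset.univ Unit (fun _ => prepare n m)
  | unitary {R : Finset (Fin n)} {K : Type} [Fintype K]
      {Ξ : K → Op (Bits (Fin n)) →ₗ[ℂ] Op (Sys m R)} (h : Circuit m n R K Ξ)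
      (U : K → Op (Bits (Fin m))) (hU : ∀ k, U k ∈ Matrix.unitaryGroup (Bits (Fin m)) ℂ) :
      Circuit m n R K (andThen Ξ (unitaryStep R U))
  | measure {R : Finset (Fin n)} {K : Type} [Fintype K]
      {Ξ : K → Op (Bits (Fin n)) →ₗ[ℂ] Op (Sys m R)} (h : Circuit m n R K Ξ)
      (S : K → Finset (Fin m)) :
      Circuit m n R (Σ k, Bits (S k)) (andThen Ξ (measureStep R S))
  | classical {R : Finset (Fin n)} {K K' : Type} [Fintype K] [Fintype K']
      {Ξ : K → Op (Bits (Fin n)) →ₗ[ℂ] Op (Sys m R)} (h : Circuit m n R K Ξ) (f : K → K') :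
      Circuit m n R K' (andThen Ξ (classicalStep m R f))
  | load {R : Finset (Fin n)} {K : Type} [Fintype K]
      {Ξ : K → Op (Bits (Fin n)) →ₗ[ℂ] Op (Sys m R)} (h : Circuit m n R K Ξ)
      (J : Finset (Fin n)) (hJ : J ⊆ R) (S : K → Finset (Fin m)) (e : ∀ k, S k ≃ J) :
      Circuit m n (R \ J) (Σ k, Bits (S k)) (andThen Ξ (loadStep hJ S e))

/-- When no input qubit is left unloaded: identify the `m` available qubits with `d` qubits and
the `nOut` output qubits along `π`, and trace out the former. -/
def outputTrace {n m d nOut : ℕ} (π : Fin m ≃ Fin d ⊕ Fin nOut) :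
    Op (Sys m (∅ : Finset (Fin n))) →ₗ[ℂ] Op (Bits (Fin nOut)) :=
  traceFst ∘ₗ relabel fun c : Bits (Fin d) × Bits (Fin nOut) =>
    ((fun i => Sum.elim c.1 c.2 (π i), fun j => absurd j.2 (Finset.notMem_empty _)) :
      Sys m (∅ : Finset (Fin n)))

/-- `Λ` is `m`-qubit implementable with delayed inputs: a circuit of elementary operations on `m`
qubits loads all input qubits and realizes every `Λ k` after discarding `m - nOut` qubits. The
final outcome set `K'` of the circuit may be larger than the outcome set `K` of `Λ`. -/
def IsImplementable (m : ℕ) {n nOut : ℕ} {K : Type}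
    (Λ : K → Op (Bits (Fin n)) →ₗ[ℂ] Op (Bits (Fin nOut))) : Prop :=
  ∃ (K' : Type) (_ : Fintype K') (Ξ : K' → Op (Bits (Fin n)) →ₗ[ℂ] Op (Sys m (∅ : Finset (Fin n))))
    (ι : K ↪ K') (d : ℕ) (π : Fin m ≃ Fin d ⊕ Fin nOut),
    Circuit m n ∅ K' Ξ ∧ ∀ k, Λ k = outputTrace π ∘ₗ Ξ (ι k)

/-! ### Unitary followed by a computational basis measurement, and the necessary conditions -/

/-- `Λ_k(ρ) = Tr_R[(|k⟩⟨k|_R ⊗ 1_out) U ρ U†]`. -/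
def unitaryMeasurement {n nR nOut : ℕ}
    (U : Matrix (Bits (Fin nR) × Bits (Fin nOut)) (Bits (Fin n)) ℂ)
    (k : Bits (Fin nR)) : Op (Bits (Fin n)) →ₗ[ℂ] Op (Bits (Fin nOut)) :=
  traceFst ∘ₗ LinearMap.mulLeft ℂ (Matrix.single k k (1 : ℂ) ⊗ₖ (1 : Op (Bits (Fin nOut)))) ∘ₗ conj U

/-- There are POVMs `E 0, …, E (T-1)` (outcome sets `{0,1}^{N t}`) and distinct input qubits
`A 0, …, A (T-1)` such that each `E t` is composable from `E (t+1)`, the last one is composable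
from the POVM associated with `Λ`, and each `E t` has no outcome signaling from `A t` and has
elements of rank at most `2^(n-(t+1))`. -/
def HasReductionChain {n nOut : ℕ} {K : Type} [Fintype K]
    (Λ : K → Op (Bits (Fin n)) →ₗ[ℂ] Op (Bits (Fin nOut))) (T : ℕ) : Prop :=
  ∃ (N : Fin T → ℕ) (E : ∀ t, Bits (Fin (N t)) → Op (Bits (Fin n))) (A : Fin T ↪ Fin n),
    (∀ t, IsPOVM (E t)) ∧
    (∀ s t : Fin T, (t : ℕ) = s + 1 → ComposableFrom (E s) (E t)) ∧
    (∀ t : Fin T, (t : ℕ) + 1 = T → ComposableFrom (E t) (assocPOVM Λ)) ∧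
    (∀ t, OutcomeNoSignaling (E t) (A t)) ∧
    (∀ t k, (E t k).rank ≤ 2 ^ (n - ((t : ℕ) + 1)))

end QubitReduction

end

/-!
A circuit on `m` qubits is unravelled into branches, one for each full record of the measurement
outcomes, so that every branch has a single Kraus operator (`Unravelling`,
`Circuit.exists_unravelling`). The input qubits in `R` that are still unloaded have not been acted
upon, so this Kraus operator has the form `B ⊗ 𝟙_R` (`liftOp`, `IndependentOf`).

Consider the POVM of the branches right after an input qubit has been loaded.
* It depends only on measurements made before the qubit was available. Hence its elements act as
  the identity on the qubit, and it has no outcome signaling from it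
  (`IsPOVM.outcomeNoSignaling`).
* Its elements are `A†A` for operators `A` into the space of the `m` available qubits and the
  qubits that remain unloaded. If there are `r` of the latter, the ranks are at most `2^(m + r)`.
* Branches are only refined later, so that the POVM is composable from every later one.

Taking these POVMs for the last `T ≤ n - m` input qubits to be loaded gives a chain (`ChainTo`) that
ends in the POVM of the branches of the entire circuit; qubits loaded together share one POVM.

It remains to compose the latter from the POVM of the instrument
(`Unravelling.composableFrom_assocPOVM`). Here it matters that the instrument consists of a unitary
and a projective measurement: each of its maps has a single nonzero Kraus operator, that is, a Choi
matrix of rank one, so the Kraus operators of all branches leading to this outcome are multiples of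
it (`exists_smul_of_sum_conj_eq`). Their squared moduli are the conditional probabilities of the
post-processing. Branches leading to additional classical values have probability zero, since the
outcomes of the instrument already have total probability one.

The argument needs only `m + T ≤ n`, which yields both the existence of the chain for `m = n - T`
and the lower bound on `m`.
-/

noncomputable section

namespace QubitReduction

/-! ### Classical post-processing of POVMs -/

section Composable

variable {a K L M : Type} [Fintype K] [Fintype L] [Fintype M]

theorem ComposableFrom.refl (E : K → Op a) : ComposableFrom E E := by
  classical
  refine ⟨fun k l => if k = l then 1 else 0, fun k l => by dsimp only; split_ifs <;> norm_num,
    fun l => by simp, fun k => ?_⟩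
  simp [apply_ite, ite_smul]

theorem ComposableFrom.trans {E : K → Op a} {F : L → Op a} {G : M → Op a}
    (hEF : ComposableFrom E F) (hFG : ComposableFrom F G) : ComposableFrom E G := by
  obtain ⟨ν, hν, hν1, hE⟩ := hEF
  obtain ⟨μ, hμ, hμ1, hF⟩ := hFG
  refine ⟨fun k l => ∑ j, ν k j * μ j l,
    fun k l => Finset.sum_nonneg fun j _ => mul_nonneg (hν k j) (hμ j l), fun l => ?_, fun k => ?_⟩
  · rw [Finset.sum_comm]
    simp [← Finset.sum_mul, hν1, hμ1]
  · rw [hE]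
    simp only [hF, Finset.smul_sum, smul_smul, Complex.ofReal_sum, Complex.ofReal_mul,
      Finset.sum_smul]
    rw [Finset.sum_comm]

open Classical in
/-- A coarse-graining of outcomes along a function is a classical post-processing. -/
theorem composableFrom_of_fiber {E : K → Op a} {F : L → Op a} (f : L → K)
    (h : ∀ k, E k = ∑ l, if f l = k then F l else 0) : ComposableFrom E F := by
  refine ⟨fun k l => if f l = k then 1 else 0, fun k l => by dsimp only; split_ifs <;> norm_num,
    fun l => by simp, fun k => ?_⟩
  rw [h]
  refine Finset.sum_congr rfl fun l _ => ?_
  by_cases hl : f l = k <;> simp [hl]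

end Composable

section Padding

variable {n : ℕ} {H : Type} [Fintype H]

theorem IsPOVM.nonempty {F : H → Op (Bits (Fin n))} (hF : IsPOVM F) : Nonempty H := by
  by_contra hH
  rw [not_nonempty_iff] at hH
  exact zero_ne_one (α := Op (Bits (Fin n))) (by simpa using hF.sum_eq_one)

theorem sum_extend_zero {L V : Type} [Fintype L] [AddCommMonoid V] {f : H → L}
    (hf : f.Injective) (F : H → V) : ∑ l, Function.extend f F 0 l = ∑ h, F h := by
  classical
  rw [← Finset.sum_subset (Finset.subset_univ (Finset.univ.image f)),
    Finset.sum_image (fun _ _ _ _ h => hf h)]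
  · simp [hf.extend_apply]
  · intro l _ hl
    rw [Function.extend_apply']
    · rfl
    · simpa using hl

theorem IsPOVM.extend {a L : Type} [Fintype a] [DecidableEq a] [Fintype L] {F : H → Op a}
    (hF : IsPOVM F) {f : H → L} (hf : f.Injective) : IsPOVM (Function.extend f F 0) := by
  refine ⟨fun l => ?_, by rw [sum_extend_zero hf, hF.sum_eq_one]⟩
  by_cases hl : ∃ h, f h = l
  · obtain ⟨h, rfl⟩ := hl
    rw [hf.extend_apply]
    exact hF.posSemidef h
  · rw [Function.extend_apply' _ _ _ hl]
    exact Matrix.PosSemidef.zero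

/-- Outcomes of zero probability can be added to a POVM so that its outcome set consists of the
bit strings of some length. This changes neither what it can be composed from nor what can be
composed from it, and preserves rank bounds and absence of signaling. -/
theorem IsPOVM.exists_bits {F : H → Op (Bits (Fin n))} (hF : IsPOVM F) :
    ∃ (N : ℕ) (E : Bits (Fin N) → Op (Bits (Fin n))), IsPOVM E ∧
      ComposableFrom E F ∧ ComposableFrom F E ∧
      (∀ q, OutcomeNoSignaling F q → OutcomeNoSignaling E q) ∧
      ∀ r, (∀ h, (F h).rank ≤ r) → ∀ k, (E k).rank ≤ r := by
  classical
  have := hF.nonempty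
  have hcard : Fintype.card H ≤ Fintype.card (Bits (Fin (Fintype.card H))) := by
    simpa using Nat.lt_two_pow_self.le
  obtain ⟨f⟩ := Function.Embedding.nonempty_of_card_le hcard
  have hf := f.injective
  refine ⟨_, Function.extend f F 0, hF.extend hf, ?_, ?_, ?_, ?_⟩
  · refine composableFrom_of_fiber f fun l => ?_
    by_cases hl : ∃ h, f h = l
    · obtain ⟨h, rfl⟩ := hl
      simp [hf.extend_apply]
    · rw [Function.extend_apply' _ _ _ hl]
      exact (Finset.sum_eq_zero fun h _ => if_neg fun e => hl ⟨h, e⟩).symm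
  · refine composableFrom_of_fiber (Function.invFun f) fun h => ?_
    have : (fun l => if Function.invFun f l = h then Function.extend f F 0 l else 0)
        = Function.extend f (fun h' => if h' = h then F h' else 0) 0 := by
      funext l
      by_cases hl : ∃ h, f h = l
      · obtain ⟨h', rfl⟩ := hl
        simp [hf.extend_apply, Function.leftInverse_invFun hf h']
      · simp [Function.extend_apply' _ _ _ hl]
    rw [this, sum_extend_zero hf]
    simp
  · rintro q ⟨G, hG, hFG⟩
    refine ⟨Function.extend f G 0, hG.extend hf, fun l ρ => ?_⟩
    by_cases hl : ∃ h, f h = l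
    · obtain ⟨h, rfl⟩ := hl
      simp only [hf.extend_apply, hFG]
    · simp [Function.extend_apply' _ _ _ hl]
  · intro r hr l
    by_cases hl : ∃ h, f h = l
    · obtain ⟨h, rfl⟩ := hl
      simpa only [hf.extend_apply] using hr h
    · simp [Function.extend_apply' _ _ _ hl]

end Padding

/-- A POVM whose elements are of the form `𝟙 ⊗ G` with the identity acting on qubit `q` has no
outcome signaling from `q`. -/
theorem IsPOVM.outcomeNoSignaling {n : ℕ} {H : Type} [Fintype H] {F : H → Op (Bits (Fin n))}
    (hF : IsPOVM F) (q : Fin n) (hoff : ∀ h b b', b q ≠ b' q → F h b b' = 0)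
    (hupd : ∀ h b b' v, b q = b' q →
      F h (Function.update b q v) (Function.update b' q v) = F h b b') :
    OutcomeNoSignaling F q := by
  set g : Fin 2 × Bits {i : Fin n // i ≠ q} → Bits (Fin n) := ⇑(Equiv.funSplitAt q (Fin 2)).symm
    with hg
  have hgq : ∀ p, g p q = p.1 := fun p => by simp [hg]
  have hgu : ∀ x v i, Function.update (g (x, i)) q v = g (v, i) := by
    intro x v i
    funext j
    by_cases hj : j = q
    · subst hj; simp [hg]
    · simp [hg, hj]
  have hginj : Function.Injective fun i => g (0, i) := fun i j h => by
    simpa using (Equiv.funSplitAt q (Fin 2)).symm.injective h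
  refine ⟨fun h => (F h).submatrix (fun i => g (0, i)) fun i => g (0, i),
    ⟨fun h => (hF.posSemidef h).submatrix _, ?_⟩, fun h ρ => ?_⟩
  · have := congrArg
      (fun M : Op (Bits (Fin n)) => M.submatrix (fun i => g (0, i)) fun i => g (0, i)) hF.sum_eq_one
    simp only [Matrix.submatrix_one _ hginj] at this
    rw [← this]
    ext i j
    simp [Matrix.sum_apply]
  · have key : ∀ x i y j, F h (g (x, i)) (g (y, j)) =
        if x = y then F h (g (0, i)) (g (0, j)) else 0 := by
      intro x i y j
      split_ifs with hxy
      · subst hxy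
        rw [← hupd h (g (x, i)) (g (x, j)) 0 (by simp [hgq]), hgu, hgu]
      · exact hoff _ _ _ (by simpa [hgq] using hxy)
    have hsum : ∀ φ : Bits (Fin n) → ℂ, ∑ b, φ b = ∑ x, ∑ i, φ (g (x, i)) := by
      intro φ
      rw [← (Equiv.funSplitAt q (Fin 2)).symm.sum_comp, Fintype.sum_prod_type]
    calc (F h * ρ).trace
        = ∑ x, ∑ i, ∑ y, ∑ j, F h (g (x, i)) (g (y, j)) * ρ (g (y, j)) (g (x, i)) := by
          simp only [Matrix.trace, Matrix.diag, Matrix.mul_apply, hsum]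
      _ = ∑ x, ∑ i, ∑ j, F h (g (0, i)) (g (0, j)) * ρ (g (x, j)) (g (x, i)) := by
          refine Finset.sum_congr rfl fun x _ => Finset.sum_congr rfl fun i _ => ?_
          rw [Finset.sum_eq_single x]
          · simp [key x i x]
          · intro y _ hy
            simp [key x i y, hy.symm]
          · simp
      _ = ∑ i, ∑ j, F h (g (0, i)) (g (0, j)) * ∑ x, ρ (g (x, j)) (g (x, i)) := by
          rw [Finset.sum_comm]
          refine Finset.sum_congr rfl fun i _ => ?_
          rw [Finset.sum_comm]
          simp only [Finset.mul_sum]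
      _ = _ := rfl

/-! ### Chains of POVMs along the loading of the input qubits -/

/-- There are `T` POVMs, each composable from the next one and the last one composable from `F`,
without outcome signaling from distinct qubits outside `R`. The ranks are bounded by `2^(m + |R|)`
for the last POVM, and the bound doubles with every step towards the first one. -/
def ChainTo {n : ℕ} (m T : ℕ) (R : Finset (Fin n)) {H : Type} [Fintype H]
    (F : H → Op (Bits (Fin n))) : Prop :=
  ∃ (E : Fin T → Σ N : ℕ, (Bits (Fin N) → Op (Bits (Fin n)))) (A : Fin T ↪ Fin n),
    (∀ t, IsPOVM (E t).2) ∧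
    (∀ s t : Fin T, (t : ℕ) = s + 1 → ComposableFrom (E s).2 (E t).2) ∧
    (∀ t : Fin T, (t : ℕ) + 1 = T → ComposableFrom (E t).2 F) ∧
    (∀ t, OutcomeNoSignaling (E t).2 (A t)) ∧
    (∀ t k, ((E t).2 k).rank ≤ 2 ^ (m + R.card + (T - ((t : ℕ) + 1)))) ∧
    ∀ t, A t ∉ R

section Chain

variable {n m T : ℕ} {R : Finset (Fin n)} {H H' : Type} [Fintype H] [Fintype H']
  {F : H → Op (Bits (Fin n))} {F' : H' → Op (Bits (Fin n))}

theorem chainTo_zero : ChainTo m 0 R F :=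
  ⟨fun t => t.elim0, ⟨fun t => t.elim0, fun t => t.elim0⟩, fun t => t.elim0, fun t => t.elim0,
    fun t => t.elim0, fun t => t.elim0, fun t => t.elim0, fun t => t.elim0⟩

theorem ChainTo.trans (h : ChainTo m T R F) (hF : ComposableFrom F F') : ChainTo m T R F' := by
  obtain ⟨E, A, h1, h2, h3, h4⟩ := h
  exact ⟨E, A, h1, h2, fun t ht => (h3 t ht).trans hF, h4⟩

/-- A POVM of small rank without outcome signaling from `q ∈ R` extends the chain. -/
theorem ChainTo.succ (h : ChainTo m T R F) (hF' : IsPOVM F') (hFF' : ComposableFrom F F')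
    {q : Fin n} (hq : q ∈ R) (hsig : OutcomeNoSignaling F' q)
    (hrank : ∀ k, (F' k).rank ≤ 2 ^ (m + (R.erase q).card)) :
    ChainTo m (T + 1) (R.erase q) F' := by
  obtain ⟨N, G, hG, hGF', hF'G, hGsig, hGrank⟩ := hF'.exists_bits
  obtain ⟨E, A, h1, h2, h3, h4, h5, h6⟩ := h
  have hcard : (R.erase q).card + 1 = R.card := Finset.card_erase_add_one hq
  obtain ⟨E', hE, hE_last⟩ : ∃ E' : Fin (T + 1) → Σ N : ℕ, (Bits (Fin N) → Op (Bits (Fin n))),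
      (∀ t : Fin T, E' t.castSucc = E t) ∧ E' (Fin.last T) = ⟨N, G⟩ :=
    ⟨Fin.snoc (α := fun _ => Σ N : ℕ, (Bits (Fin N) → Op (Bits (Fin n)))) E ⟨N, G⟩,
      fun t => Fin.snoc_castSucc .., Fin.snoc_last ..⟩
  refine ⟨E',
    ⟨Fin.snoc (α := fun _ => Fin n) A q, ?_⟩, ?_, ?_, ?_, ?_, ?_, ?_⟩
  · rw [Fin.snoc_injective_iff]
    refine ⟨A.injective, ?_⟩
    rintro ⟨t, rfl⟩
    exact h6 t hq
  · refine Fin.lastCases ?_ fun t => ?_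
    · rw [hE_last]; exact hG
    · rw [hE]; exact h1 t
  · refine fun s => Fin.lastCases (fun hst => ?_) (fun t hst => ?_)
    · obtain ⟨s, rfl⟩ : ∃ s' : Fin T, s = s'.castSucc := ⟨⟨s, by simp at hst; omega⟩, rfl⟩
      rw [hE, hE_last]
      exact ((h3 s (by simpa using hst.symm)).trans hFF').trans hF'G
    · obtain ⟨s, rfl⟩ : ∃ s' : Fin T, s = s'.castSucc :=
        ⟨⟨s, by have := t.2; simp at hst; omega⟩, rfl⟩
      rw [hE, hE]
      exact h2 s t (by simpa using hst)
  · refine Fin.lastCases (fun _ => ?_) (fun t ht => ?_)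
    · rw [hE_last]; exact hGF'
    · have := t.2
      simp at ht
      omega
  · refine Fin.lastCases ?_ fun t => ?_
    · rw [hE_last]; simpa using hGsig q hsig
    · rw [hE]; simpa using h4 t
  · refine Fin.lastCases ?_ fun t => ?_
    · rw [hE_last]; simpa using hGrank _ hrank
    · intro k
      have := t.2
      have e : m + (R.erase q).card + (T + 1 - ((t.castSucc : ℕ) + 1))
          = m + R.card + (T - ((t : ℕ) + 1)) := by
        simp only [Fin.val_castSucc]
        omega
      rw [e]
      revert k
      rw [hE]
      exact h5 t
  · refine Fin.lastCases ?_ fun t => ?_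
    · simp
    · simpa using fun _ => h6 t

/-- Loading the qubits in `J` jointly extends the chain by one copy of the same POVM for each of
them. -/
theorem ChainTo.load (h : ∀ T, T + R.card ≤ n → ChainTo m T R F) (hF' : IsPOVM F')
    (hFF' : ComposableFrom F F') {J : Finset (Fin n)} (hJ : J ⊆ R)
    (hsig : ∀ q ∈ J, OutcomeNoSignaling F' q)
    (hrank : ∀ k, (F' k).rank ≤ 2 ^ (m + (R \ J).card)) :
    ∀ T, T + (R \ J).card ≤ n → ChainTo m T (R \ J) F' := by
  suffices ∀ I, I ⊆ J → ∀ T, T + (R \ I).card ≤ n → ChainTo m T (R \ I) F' from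
    this J subset_rfl
  intro I
  induction I using Finset.induction_on with
  | empty =>
    intro _ T hT
    rw [Finset.sdiff_empty] at hT ⊢
    exact (h T hT).trans hFF'
  | insert q I hqI ih =>
    intro hI T hT
    obtain ⟨hqJ, hIJ⟩ := Finset.insert_subset_iff.1 hI
    have hq : q ∈ R \ I := Finset.mem_sdiff.2 ⟨hJ hqJ, hqI⟩
    have hcard := Finset.card_erase_add_one hq
    have hle : (R \ J).card ≤ (R \ insert q I).card :=
      Finset.card_le_card (Finset.sdiff_subset_sdiff subset_rfl hI)
    rw [Finset.sdiff_insert] at hT hle ⊢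
    cases T with
    | zero => exact chainTo_zero
    | succ T =>
      exact (ih hIJ T (by omega)).succ hF' (ComposableFrom.refl _) hq (hsig q hqJ) fun k =>
        (hrank k).trans (Nat.pow_le_pow_right two_pos (by omega))

end Chain

/-! ### Kraus operators acting trivially on the unloaded qubits -/

theorem conj_comp {a b c : Type} [Fintype a] [Fintype b] (L : Matrix c b ℂ) (K : Matrix b a ℂ) :
    conj L ∘ₗ conj K = conj (L * K) := by
  ext1 ρ
  simp [conj, Matrix.mul_assoc, Matrix.conjTranspose_mul]

theorem conj_one {a : Type} [Fintype a] [DecidableEq a] :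
    conj (1 : Op a) = LinearMap.id := by
  ext1 ρ
  simp [conj]

section Lift

variable {m n : ℕ} {R J : Finset (Fin n)}

/-- The operator `H_in → H_m ⊗ H_R` that copies the input qubits in `R` and applies `B` to obtain
the state of the `m` available qubits. For `B` independent of the qubits in `R`
(`IndependentOf`) this is `B ⊗ 𝟙_R`. -/
def liftOp (R : Finset (Fin n)) (B : Matrix (Bits (Fin m)) (Bits (Fin n)) ℂ) :
    Matrix (Sys m R) (Bits (Fin n)) ℂ :=
  Matrix.of fun c b => if c.2 = fun j : R => b j then B c.1 b else 0

/-- The matrix elements of `B` do not depend on the basis labels of the input qubits in `R`. -/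
def IndependentOf (R : Finset (Fin n)) (B : Matrix (Bits (Fin m)) (Bits (Fin n)) ℂ) : Prop :=
  ∀ c b b', (∀ i ∉ R, b i = b' i) → B c b = B c b'

theorem IndependentOf.mul_left {B : Matrix (Bits (Fin m)) (Bits (Fin n)) ℂ}
    (hB : IndependentOf R B) (V : Op (Bits (Fin m))) : IndependentOf R (V * B) := by
  intro c b b' h
  simp only [Matrix.mul_apply, hB _ b b' h]

theorem kronecker_one_mul_liftOp (V : Op (Bits (Fin m)))
    (B : Matrix (Bits (Fin m)) (Bits (Fin n)) ℂ) :
    (V ⊗ₖ (1 : Op (Bits R))) * liftOp R B = liftOp R (V * B) := by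
  ext ⟨c, r⟩ b
  simp only [Matrix.mul_apply, Fintype.sum_prod_type, Matrix.kroneckerMap_apply,
    Matrix.one_apply, liftOp, Matrix.of_apply]
  by_cases h : r = fun j : R => b j <;> simp [h]

/-- The unloaded qubits contribute the identity to `(B ⊗ 𝟙)† (D ⊗ 𝟙) (B ⊗ 𝟙)`. -/
theorem liftOp_sandwich_apply (B : Matrix (Bits (Fin m)) (Bits (Fin n)) ℂ)
    (φ : Bits (Fin m) → ℂ) (b b' : Bits (Fin n)) :
    ((liftOp R B)ᴴ * (Matrix.diagonal (fun c : Sys m R => φ c.1) * liftOp R B)) b b' =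
      if ∀ j ∈ R, b j = b' j then ∑ c, star (B c b) * (φ c * B c b') else 0 := by
  rw [Matrix.mul_apply]
  simp only [Matrix.diagonal_mul, Fintype.sum_prod_type,
    Matrix.conjTranspose_apply, liftOp, Matrix.of_apply]
  have : (∀ j ∈ R, b j = b' j) ↔ (fun j : R => b j) = fun j : R => b' j := by
    simp [funext_iff]
  simp only [this]
  split_ifs with h
  · refine Finset.sum_congr rfl fun c _ => ?_
    rw [Finset.sum_eq_single (fun j : R => b j)]
    · simp [← h]
    · intro r _ hr
      simp [hr]
    · simp
  · refine Finset.sum_eq_zero fun c _ => Finset.sum_eq_zero fun r _ => ?_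
    by_cases hr : r = fun j : R => b j
    · subst hr
      simp [h]
    · simp [hr]

open Classical in
/-- The operator on the available qubits after measuring `S` with outcome `x` and placing the
input qubit `e i` into the slot `i ∈ S`. -/
def loadedOp (S : Finset (Fin m)) (e : S ≃ J) (x : Bits S)
    (B : Matrix (Bits (Fin m)) (Bits (Fin n)) ℂ) : Matrix (Bits (Fin m)) (Bits (Fin n)) ℂ :=
  Matrix.of fun c b => if ∀ i : S, c i = b (e i) then
    B (fun i => if h : i ∈ S then x ⟨i, h⟩ else c i) b else 0

theorem IndependentOf.loadedOp {B : Matrix (Bits (Fin m)) (Bits (Fin n)) ℂ}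
    (hB : IndependentOf R B) (S : Finset (Fin m)) (e : S ≃ J) (x : Bits S) :
    IndependentOf (R \ J) (loadedOp S e x B) := by
  intro c b b' h
  have hJ : ∀ i : S, b (e i) = b' (e i) := fun i => h _ fun hi => (Finset.mem_sdiff.1 hi).2 (e i).2
  simp only [QubitReduction.loadedOp, Matrix.of_apply, hJ,
    hB _ b b' fun i hi => h i fun hi' => hi (Finset.mem_sdiff.1 hi').1]

theorem loadOp_mul_liftOp (hJ : J ⊆ R) (S : Finset (Fin m)) (e : S ≃ J) (x : Bits S)
    (B : Matrix (Bits (Fin m)) (Bits (Fin n)) ℂ) :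
    loadOp hJ S e x * liftOp R B = liftOp (R \ J) (loadedOp S e x B) := by
  classical
  ext ⟨c, r⟩ b
  -- For the row `(c, r)` and the input `b` only the following column can contribute.
  set c₀ : Bits (Fin m) := fun i => if h : i ∈ S then x ⟨i, h⟩ else c i with hc₀
  rw [Matrix.mul_apply, Finset.sum_eq_single ((c₀, fun j => b j) : Sys m R)]
  · simp only [loadOp, liftOp, loadedOp, Matrix.of_apply, ← hc₀]
    have h1 : ∀ i : S, c₀ i = x i := fun i => by simp [hc₀]
    have h2 : ∀ i ∉ S, c i = c₀ i := fun i hi => by simp [hc₀, hi]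
    simp only [h1, implies_true, true_and, if_true, funext_iff]
    simp only [eq_true h2, true_and, ite_mul, one_mul, zero_mul, ← ite_and]
    exact if_congr and_comm rfl rfl
  · rintro ⟨c', r'⟩ - hne
    simp only [loadOp, liftOp, Matrix.of_apply]
    split_ifs with h h'
    · refine absurd ?_ hne
      refine Prod.ext (funext fun i => ?_) h'
      by_cases hi : i ∈ S
      · simpa [hc₀, hi] using h.1 ⟨i, hi⟩
      · simpa [hc₀, hi] using (h.2.1 i hi).symm
    all_goals simp
  · simp

end Lift

/-! ### Completeness of the elementary operations -/

section Complete

/-- A partial isometry that maps basis vectors satisfying `p` injectively to basis vectors. -/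
theorem conjTranspose_mul_self_of_partial_injection {a b : Type} [Fintype b]
    [DecidableEq a] [DecidableEq b] (M : Matrix b a ℂ) (p : a → Prop) [DecidablePred p] (φ : a → b)
    (hM : ∀ i j, M i j = if p j ∧ i = φ j then 1 else 0)
    (hφ : ∀ j k, p j → p k → φ j = φ k → j = k) :
    Mᴴ * M = Matrix.diagonal fun j => if p j then 1 else 0 := by
  ext j k
  simp only [Matrix.mul_apply, Matrix.conjTranspose_apply, hM, Matrix.diagonal_apply]
  rw [Finset.sum_eq_single (φ j)]
  · by_cases hj : p j <;> by_cases hk : p k <;> by_cases hjk : j = k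
    all_goals first | subst hjk | skip
    all_goals simp_all
    exact fun h => hjk (hφ j k hj hk h)
  · intro i _ hi
    simp [hi]
  · simp

variable {m n : ℕ} {R J : Finset (Fin n)}

/-- The diagonal of the projection `|x⟩⟨x|_S ⊗ 𝟙` on the available qubits. -/
def outcomeIndicator (S : Finset (Fin m)) (x : Bits S) (c : Bits (Fin m)) : ℂ :=
  if ∀ i : S, c i = x i then 1 else 0

theorem sum_outcomeIndicator (S : Finset (Fin m)) (c : Bits (Fin m)) :
    ∑ x, outcomeIndicator S x c = 1 := by
  classical
  rw [Finset.sum_eq_single (fun i : S => c i)]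
  · simp [outcomeIndicator]
  · intro x _ hx
    exact if_neg fun h => hx (funext fun i => (h i).symm)
  · simp

theorem measOp_conjTranspose_mul_self (S : Finset (Fin m)) (x : Bits S) :
    (measOp S x)ᴴ * measOp S x = Matrix.diagonal (outcomeIndicator S x) := by
  refine (conjTranspose_mul_self_of_partial_injection _ (fun c : Bits (Fin m) => ∀ i : S, c i = x i)
    (fun (c : Bits (Fin m)) i => if i ∈ S then 0 else c i) (fun c c₀ => ?_) fun c d hc hd h =>
      ?_).trans rfl
  · simp only [measOp, Matrix.of_apply]
    refine if_congr ⟨fun h => ⟨fun i => (h.1 i).1, funext fun i => ?_⟩,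
      fun h => ⟨fun i => ⟨h.1 i, ?_⟩, fun i hi => ?_⟩⟩ rfl rfl
    · by_cases hi : i ∈ S
      · simpa [hi] using (h.1 ⟨i, hi⟩).2
      · simpa [hi] using h.2 i hi
    · simp [h.2]
    · simp [h.2, hi]
  · funext i
    by_cases hi : i ∈ S
    · exact (hc ⟨i, hi⟩).trans (hd ⟨i, hi⟩).symm
    · simpa [hi] using congrFun h i

theorem loadOp_conjTranspose_mul_self (hJ : J ⊆ R) (S : Finset (Fin m)) (e : S ≃ J) (x : Bits S) :
    (loadOp hJ S e x)ᴴ * loadOp hJ S e x =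
      Matrix.diagonal fun c => outcomeIndicator S x c.1 := by
  refine (conjTranspose_mul_self_of_partial_injection _ (fun c : Sys m R => ∀ i : S, c.1 i = x i)
    (fun c : Sys m R => (fun i => if h : i ∈ S then c.2 ⟨e ⟨i, h⟩, hJ (e ⟨i, h⟩).2⟩ else c.1 i,
      fun j : ↥(R \ J) => c.2 ⟨j, Finset.sdiff_subset j.2⟩)) (fun c c₀ => ?_) fun c d hc hd h =>
      ?_).trans rfl
  · simp only [loadOp, Matrix.of_apply]
    refine if_congr (and_congr_right fun _ => ⟨fun h => Prod.ext (funext fun i => ?_)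
      (funext h.2.2), fun h => ?_⟩) rfl rfl
    · by_cases hi : i ∈ S
      · simpa [hi] using h.2.1 ⟨i, hi⟩
      · simpa [hi] using h.1 i hi
    · rw [h]
      exact ⟨fun i hi => by simp [hi], fun i => by simp, fun j => rfl⟩
  · rw [Prod.mk.injEq] at h
    refine Prod.ext (funext fun i => ?_) (funext fun j => ?_)
    · by_cases hi : i ∈ S
      · exact (hc ⟨i, hi⟩).trans (hd ⟨i, hi⟩).symm
      · simpa [hi] using congrFun h.1 i
    · by_cases hj : (j : Fin n) ∈ J
      · have := congrFun h.1 (e.symm ⟨j, hj⟩)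
        simpa using this
      · exact congrFun h.2 ⟨j, Finset.mem_sdiff.2 ⟨j.2, hj⟩⟩

theorem sum_measOp (S : Finset (Fin m)) :
    ∑ x, (measOp S x ⊗ₖ (1 : Op (Bits R)))ᴴ * (measOp S x ⊗ₖ (1 : Op (Bits R))) = 1 := by
  simp only [Matrix.conjTranspose_kronecker, ← Matrix.mul_kronecker_mul,
    measOp_conjTranspose_mul_self, Matrix.conjTranspose_one, Matrix.mul_one]
  ext ⟨c, r⟩ ⟨c', r'⟩
  by_cases h : c = c'
  · subst h
    simp [Matrix.sum_apply, Matrix.kroneckerMap_apply, sum_outcomeIndicator,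
      Matrix.one_apply]
  · simp [Matrix.sum_apply, Matrix.kroneckerMap_apply, Matrix.one_apply, h]

theorem sum_loadOp (hJ : J ⊆ R) (S : Finset (Fin m)) (e : S ≃ J) :
    ∑ x, (loadOp hJ S e x)ᴴ * loadOp hJ S e x = 1 := by
  simp only [loadOp_conjTranspose_mul_self]
  ext c c'
  by_cases h : c = c'
  · subst h
    simp [Matrix.sum_apply, sum_outcomeIndicator]
  · simp [Matrix.sum_apply, h]

end Complete

/-! ### Unravelling circuits into branches with a single Kraus operator -/

/-- The POVM elements `A†A` of Kraus operators `A = liftOp R (B h)`. -/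
def branchPOVM {m n : ℕ} (R : Finset (Fin n)) {H : Type}
    (B : H → Matrix (Bits (Fin m)) (Bits (Fin n)) ℂ) (h : H) : Op (Bits (Fin n)) :=
  (liftOp R (B h))ᴴ * liftOp R (B h)

open Classical in
/-- An unravelling of the instrument `Ξ`, reached with the input qubits in `R` unloaded: a branch
`h` is a full record of the measurement outcomes, `B h ⊗ 𝟙_R` is its Kraus operator, and `κ h` is
the classical value that it leads to. -/
structure Unravelling {m n : ℕ} (R : Finset (Fin n)) {K H : Type} [Fintype H]
    (Ξ : K → Op (Bits (Fin n)) →ₗ[ℂ] Op (Sys m R))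
    (B : H → Matrix (Bits (Fin m)) (Bits (Fin n)) ℂ) (κ : H → K) : Prop where
  independent : ∀ h, IndependentOf R (B h)
  sum_eq_one : ∑ h, branchPOVM R B h = 1
  eq_sum : ∀ k, Ξ k = ∑ h, if κ h = k then conj (liftOp R (B h)) else 0

namespace Unravelling

variable {m n : ℕ} {R R' : Finset (Fin n)} {K K' H : Type} [Fintype H]
  {Ξ : K → Op (Bits (Fin n)) →ₗ[ℂ] Op (Sys m R)}
  {B : H → Matrix (Bits (Fin m)) (Bits (Fin n)) ℂ} {κ : H → K}

theorem isPOVM (hΞ : Unravelling R Ξ B κ) : IsPOVM (branchPOVM R B) :=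
  ⟨fun _ => Matrix.posSemidef_conjTranspose_mul_self _, hΞ.sum_eq_one⟩

open Classical in
/-- A round that applies one of the Kraus operators `L k x`, `x ∈ X k`, refines every branch. The
previous branches are obtained from the new ones by forgetting `x`. -/
theorem andThen [Fintype K] (hΞ : Unravelling R Ξ B κ) {X : K → Type} [∀ k, Fintype (X k)]
    {Φ : CondMaps m K K' R R'} (f : ∀ k, X k → K')
    (L : ∀ k, X k → Matrix (Sys m R') (Sys m R) ℂ)
    (hΦ : ∀ k k', Φ k k' = ∑ x, if k' = f k x then conj (L k x) else 0)
    (hL : ∀ k, ∑ x, (L k x)ᴴ * L k x = 1)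
    (B' : (Σ h, X (κ h)) → Matrix (Bits (Fin m)) (Bits (Fin n)) ℂ)
    (hB' : ∀ p, L (κ p.1) p.2 * liftOp R (B p.1) = liftOp R' (B' p))
    (hind : ∀ p, IndependentOf R' (B' p)) :
    Unravelling R' (QubitReduction.andThen Ξ Φ) B' (fun p => f (κ p.1) p.2) ∧
      ComposableFrom (branchPOVM R B) (branchPOVM R' B') := by
  have hsum : ∀ h, ∑ x, branchPOVM R' B' ⟨h, x⟩ = branchPOVM R B h := by
    intro h
    have : ∀ x, branchPOVM R' B' ⟨h, x⟩ =
        (liftOp R (B h))ᴴ * ((L (κ h) x)ᴴ * L (κ h) x) * liftOp R (B h) := by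
      intro x
      simp only [branchPOVM, ← hB', Matrix.conjTranspose_mul, Matrix.mul_assoc]
    rw [Finset.sum_congr rfl fun x _ => this x, ← Matrix.sum_mul, ← Matrix.mul_sum, hL,
      Matrix.mul_one, branchPOVM]
  refine ⟨⟨hind, ?_, fun k' => ?_⟩, composableFrom_of_fiber Sigma.fst fun h => ?_⟩
  · rw [Fintype.sum_sigma]
    simp only [hsum, hΞ.sum_eq_one]
  · rw [Fintype.sum_sigma]
    have : ∀ k, Φ k k' ∘ₗ Ξ k = ∑ h, if κ h = k then
        ∑ x, (if f k x = k' then conj (L k x * liftOp R (B h)) else 0) else 0 := by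
      intro k
      rw [hΞ.eq_sum, hΦ]
      ext1 ρ
      simp only [LinearMap.comp_apply, LinearMap.sum_apply, map_sum]
      refine Finset.sum_congr rfl fun h _ => ?_
      split_ifs
      · simp only [LinearMap.sum_apply]
        refine Finset.sum_congr rfl fun x _ => ?_
        simp only [eq_comm (a := k')]
        split_ifs
        · rw [← conj_comp]
          rfl
        · rfl
      · simp
    simp only [QubitReduction.andThen, this]
    rw [Finset.sum_comm]
    refine Finset.sum_congr rfl fun h _ => ?_
    simp only [Finset.sum_ite_eq, Finset.mem_univ, if_true, ← hB']
  · rw [Fintype.sum_sigma, ← hsum]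
    rw [Finset.sum_eq_single h]
    · simp
    · intro h' _ hne
      simp [hne]
    · simp

end Unravelling

/-- Every circuit can be unravelled. Moreover, the POVM of its branches refines a chain of POVMs,
one for each input qubit that has been loaded: the POVM of the branches right after that qubit has
been loaded. It has no signaling from the qubit, which has not been acted upon, and its ranks are
bounded by the dimension of the `m` available and the unloaded qubits. -/
theorem Circuit.exists_unravelling {m n : ℕ} {R : Finset (Fin n)} {K : Type}
    {Ξ : K → Op (Bits (Fin n)) →ₗ[ℂ] Op (Sys m R)} (hΞ : Circuit m n R K Ξ) :
    ∃ (H : Type) (_ : Fintype H) (B : H → Matrix (Bits (Fin m)) (Bits (Fin n)) ℂ) (κ : H → K),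
      Unravelling R Ξ B κ ∧ ∀ T, T + R.card ≤ n → ChainTo m T R (branchPOVM R B) := by
  classical
  induction hΞ with
  | start =>
    refine ⟨Unit, inferInstance, fun _ => Matrix.of fun c _ => if c = 0 then 1 else 0,
      fun _ => (), ⟨fun _ _ _ _ _ => rfl, ?_, fun _ => ?_⟩, fun T hT => ?_⟩
    · ext b b'
      have := liftOp_sandwich_apply (R := (Finset.univ : Finset (Fin n)))
        (Matrix.of fun (c : Bits (Fin m)) _ => if c = 0 then (1 : ℂ) else 0) (fun _ => 1) b b'
      simp only [Matrix.diagonal_one, Matrix.one_mul] at this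
      rw [Fintype.sum_unique, branchPOVM, this]
      simp [Matrix.one_apply, funext_iff (f := b)]
    · simp only [if_true, Finset.univ_unique, Finset.sum_singleton]
      ext1 ρ
      ext ⟨c, r⟩ ⟨c', r'⟩
      have hr : ∀ (r : Bits ↥(Finset.univ : Finset (Fin n))) (b : Bits (Fin n)),
          (r = fun j : ↥(Finset.univ : Finset (Fin n)) => b j) ↔
            b = fun i => r ⟨i, Finset.mem_univ i⟩ := by
        intro r b
        simp [funext_iff, eq_comm]
      simp only [prepare, conj, LinearMap.coe_mk, AddHom.coe_mk, Matrix.kroneckerMap_apply,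
        Matrix.single_apply, Matrix.submatrix_apply, Matrix.mul_apply, Matrix.conjTranspose_apply,
        liftOp, Matrix.of_apply, hr]
      by_cases hc : c = 0 <;> by_cases hc' : c' = 0 <;>
        simp [hc, hc', eq_comm (a := (0 : Bits (Fin m)))]
    · rw [Finset.card_univ, Fintype.card_fin] at hT
      obtain rfl : T = 0 := by omega
      exact chainTo_zero
  | @unitary R K _ Ξ _ U hU ih =>
    obtain ⟨H, _, B, κ, hΞ, hch⟩ := ih
    obtain ⟨h1, h2⟩ := hΞ.andThen (X := fun _ => Unit) (Φ := unitaryStep R U) (fun k _ => k)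
      (fun k _ => U k ⊗ₖ (1 : Op (Bits R))) (fun k k' => by simp [unitaryStep])
      (fun k => by
        have := Matrix.mem_unitaryGroup_iff'.1 (hU k)
        rw [Matrix.star_eq_conjTranspose] at this
        simp [Matrix.conjTranspose_kronecker, ← Matrix.mul_kronecker_mul, this])
      (fun p => U (κ p.1) * B p.1) (fun p => kronecker_one_mul_liftOp _ _)
      (fun p => (hΞ.independent _).mul_left _)
    exact ⟨_, _, _, _, h1, fun T hT => (hch T hT).trans h2⟩
  | @measure R K _ Ξ _ S ih =>
    obtain ⟨H, _, B, κ, hΞ, hch⟩ := ih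
    obtain ⟨h1, h2⟩ := hΞ.andThen (Φ := measureStep R S) (fun k x => ⟨k, x⟩)
      (fun k x => measOp (S k) x ⊗ₖ (1 : Op (Bits R))) (fun k k' => by
        unfold measureStep
        refine Finset.sum_congr rfl fun x _ => ?_
        congr)
      (fun k => sum_measOp _)
      (fun p => measOp (S (κ p.1)) p.2 * B p.1) (fun p => kronecker_one_mul_liftOp _ _)
      (fun p => (hΞ.independent _).mul_left _)
    exact ⟨_, _, _, _, h1, fun T hT => (hch T hT).trans h2⟩
  | @classical R K K' _ _ Ξ _ f ih =>
    obtain ⟨H, _, B, κ, hΞ, hch⟩ := ih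
    obtain ⟨h1, h2⟩ := hΞ.andThen (X := fun _ => Unit) (Φ := classicalStep m R f) (fun k _ => f k)
      (fun k _ => 1) (fun k k' => by simp [classicalStep, conj_one]) (fun k => by simp)
      (fun p => B p.1) (fun p => by rw [Matrix.one_mul]) (fun p => hΞ.independent _)
    exact ⟨_, _, _, _, h1, fun T hT => (hch T hT).trans h2⟩
  | @load R K _ Ξ _ J hJ S e ih =>
    obtain ⟨H, _, B, κ, hΞ, hch⟩ := ih
    obtain ⟨h1, h2⟩ := hΞ.andThen (Φ := loadStep hJ S e) (fun k x => ⟨k, x⟩)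
      (fun k x => loadOp hJ (S k) (e k) x) (fun k k' => by
        unfold loadStep
        refine Finset.sum_congr rfl fun x _ => ?_
        congr)
      (fun k => sum_loadOp _ _ _)
      (fun p => loadedOp (S (κ p.1)) (e (κ p.1)) p.2 (B p.1)) (fun p => loadOp_mul_liftOp _ _ _ _ _)
      (fun p => (hΞ.independent _).loadedOp _ _ _)
    refine ⟨_, _, _, _, h1, ChainTo.load hch h1.isPOVM h2 hJ (fun q hq => ?_) fun p => ?_⟩
    · -- Before the loaded qubits take the place of the measured ones, the Kraus operators are
      -- `(|x⟩⟨x|_S B) ⊗ 𝟙_R`, so that they act trivially on `q ∈ J ⊆ R`.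
      have key : ∀ (p : Σ h, Bits (S (κ h))) (b b' : Bits (Fin n)), branchPOVM (R \ J)
          (fun p : Σ h, Bits (S (κ h)) => loadedOp (S (κ p.1)) (e (κ p.1)) p.2 (B p.1)) p b b' =
          if ∀ j ∈ R, b j = b' j then ∑ c, star (B p.1 c b) *
            (outcomeIndicator (S (κ p.1)) p.2 c * B p.1 c b') else 0 := by
        intro p b b'
        rw [← liftOp_sandwich_apply, ← loadOp_conjTranspose_mul_self hJ _ (e (κ p.1)), branchPOVM,
          ← loadOp_mul_liftOp hJ, Matrix.conjTranspose_mul, Matrix.mul_assoc, Matrix.mul_assoc]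
      refine h1.isPOVM.outcomeNoSignaling q (fun p b b' hb => ?_) fun p b b' v hb => ?_
      · rw [key, if_neg fun h => hb (h q (hJ hq))]
      · have hB : ∀ c b, B p.1 c (Function.update b q v) = B p.1 c b := fun c b =>
          hΞ.independent _ _ _ _ fun i hi =>
            Function.update_of_ne (by rintro rfl; exact hi (hJ hq)) ..
        rw [key, key]
        simp only [hB]
        refine if_congr (forall₂_congr fun j _ => ?_) rfl rfl
        by_cases hj : j = q
        · subst hj
          simp [hb]
        · simp [hj]
    · refine (Matrix.rank_mul_le_right _ _).trans ((Matrix.rank_le_card_height _).trans ?_)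
      rw [Fintype.card_prod, Fintype.card_fun, Fintype.card_fun, Fintype.card_fin, Fintype.card_fin,
        Fintype.card_coe, pow_add]

/-! ### Instruments with a single Kraus operator per outcome -/

section Choi

variable {a b I : Type} [Fintype a] [Fintype I] {L : I → Matrix b a ℂ} {K : Matrix b a ℂ}

theorem conj_single_apply [DecidableEq a] (M : Matrix b a ℂ) (i j : a) (p q : b) :
    conj M (Matrix.single i j 1) p q = M p i * star (M q j) := by
  simp [conj, Matrix.mul_apply, Matrix.single_apply, ite_and]

/-- Equality of the Choi matrices. -/
theorem sum_mul_star_of_sum_conj_eq (h : ∑ l, conj (L l) = conj K) (p q : b) (i j : a) :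
    ∑ l, L l p i * star (L l q j) = K p i * star (K q j) := by
  classical
  have := congrFun (congrFun (LinearMap.congr_fun h (Matrix.single i j 1)) p) q
  simpa only [LinearMap.sum_apply, Matrix.sum_apply, conj_single_apply] using this

theorem sum_conjTranspose_mul_self_of_sum_conj_eq [Fintype b] (h : ∑ l, conj (L l) = conj K) :
    ∑ l, (L l)ᴴ * L l = Kᴴ * K := by
  ext i j
  simp only [Matrix.sum_apply, Matrix.mul_apply, Matrix.conjTranspose_apply]
  rw [Finset.sum_comm]
  refine Finset.sum_congr rfl fun p _ => ?_
  have := sum_mul_star_of_sum_conj_eq h p p j i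
  simpa only [mul_comm] using this

/-- A map with a single Kraus operator has no other decompositions than those into multiples of
this operator, because its Choi matrix has rank one. -/
theorem exists_smul_of_sum_conj_eq (h : ∑ l, conj (L l) = conj K) (hK : K ≠ 0) :
    ∃ c : I → ℂ, ∀ l, L l = c l • K := by
  obtain ⟨p, i, hpi⟩ : ∃ p i, K p i ≠ 0 := by
    by_contra! h0
    exact hK (Matrix.ext h0)
  refine ⟨fun l => L l p i / K p i, fun l => ?_⟩
  ext q j
  -- The squared norms of the entries of `K p i • L l q j - K q j • L l p i` sum to zero.
  have hsum : ∑ l, (L l q j * K p i - L l p i * K q j) *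
      star (L l q j * K p i - L l p i * K q j) = 0 := by
    have hexp : ∀ l, (L l q j * K p i - L l p i * K q j) *
        star (L l q j * K p i - L l p i * K q j) =
        K p i * star (K p i) * (L l q j * star (L l q j)) -
        K p i * star (K q j) * (L l q j * star (L l p i)) -
        K q j * star (K p i) * (L l p i * star (L l q j)) +
        K q j * star (K q j) * (L l p i * star (L l p i)) := by
      intro l
      simp only [star_sub, star_mul']
      ring
    simp only [hexp, Finset.sum_add_distrib, Finset.sum_sub_distrib, ← Finset.mul_sum,
      sum_mul_star_of_sum_conj_eq h]
    ring
  have hz := (Finset.sum_eq_zero_iff_of_nonneg fun l _ => mul_star_self_nonneg _).1 hsum l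
    (Finset.mem_univ l)
  rw [mul_eq_zero, star_eq_zero, or_self, sub_eq_zero] at hz
  simp only [Matrix.smul_apply, smul_eq_mul]
  field_simp
  exact hz

theorem assocPOVM_of_eq_conj {K₀ : Type} [Fintype b] [DecidableEq a] {Λ : K₀ → Op a →ₗ[ℂ] Op b}
    {k : K₀} (h : Λ k = conj K) : assocPOVM Λ k = Kᴴ * K := by
  ext i j
  simp only [assocPOVM, Matrix.of_apply, h, Matrix.trace, Matrix.diag, conj_single_apply,
    Matrix.mul_apply, Matrix.conjTranspose_apply, mul_comm]

end Choi

section UnitaryMeasurement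

variable {n nR nOut : ℕ} (U : Matrix (Bits (Fin nR) × Bits (Fin nOut)) (Bits (Fin n)) ℂ)

/-- The operator `(⟨k|_R ⊗ 𝟙_out) U`. -/
def outcomeOp (k : Bits (Fin nR)) : Matrix (Bits (Fin nOut)) (Bits (Fin n)) ℂ :=
  U.submatrix (fun i => (k, i)) id

theorem unitaryMeasurement_eq_conj (k : Bits (Fin nR)) :
    unitaryMeasurement U k = conj (outcomeOp U k) := by
  ext1 ρ
  have h : conj (outcomeOp U k) ρ = (conj U ρ).submatrix (fun i => (k, i)) fun i => (k, i) := rfl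
  rw [h]
  ext i j
  simp [unitaryMeasurement, traceFst, Matrix.mul_apply, Fintype.sum_prod_type, Matrix.single_apply,
    Matrix.one_apply, ite_and]

variable {U}

theorem outcomeOp_ne_zero (hU : U * Uᴴ = 1) (k : Bits (Fin nR)) : outcomeOp U k ≠ 0 := by
  intro h
  have h1 := congrFun (congrFun hU (k, 0)) (k, 0)
  have h0 : ∀ b, U (k, 0) b = 0 := fun b => congrFun (congrFun h 0) b
  simp [Matrix.mul_apply, h0] at h1

theorem sum_outcomeOp (hU : Uᴴ * U = 1) : ∑ k, (outcomeOp U k)ᴴ * outcomeOp U k = 1 := by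
  rw [← hU]
  ext i j
  simp [Matrix.sum_apply, Matrix.mul_apply, Fintype.sum_prod_type, outcomeOp]

end UnitaryMeasurement

section Output

variable {m n d nOut : ℕ} (π : Fin m ≃ Fin d ⊕ Fin nOut)

/-- The basis labels of the discarded and the output qubits, as those of the whole system. -/
def outputEquiv : Bits (Fin d) × Bits (Fin nOut) ≃ Sys m (∅ : Finset (Fin n)) where
  toFun c := (fun i => Sum.elim c.1 c.2 (π i), fun j => absurd j.2 (Finset.notMem_empty _))
  invFun s := (fun i => s.1 (π.symm (Sum.inl i)), fun i => s.1 (π.symm (Sum.inr i)))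
  left_inv c := by simp
  right_inv s := by
    refine Prod.ext (funext fun i => ?_) (funext fun j => absurd j.2 (Finset.notMem_empty _))
    obtain ⟨i, rfl⟩ := π.symm.surjective i
    cases i <;> simp

/-- The Kraus operator `(⟨y| ⊗ 𝟙_out) A`, when the discarded qubits are found in the state `y`. -/
def outputOp (A : Matrix (Sys m (∅ : Finset (Fin n))) (Bits (Fin n)) ℂ) (y : Bits (Fin d)) :
    Matrix (Bits (Fin nOut)) (Bits (Fin n)) ℂ :=
  A.submatrix (fun i => outputEquiv π (y, i)) id

theorem outputTrace_comp_conj (A : Matrix (Sys m (∅ : Finset (Fin n))) (Bits (Fin n)) ℂ) :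
    outputTrace π ∘ₗ conj A = ∑ y, conj (outputOp π A y) := by
  ext1 ρ
  ext i j
  simp only [LinearMap.sum_apply, Matrix.sum_apply]
  rfl

theorem sum_outputOp (A : Matrix (Sys m (∅ : Finset (Fin n))) (Bits (Fin n)) ℂ) :
    ∑ y, (outputOp π A y)ᴴ * outputOp π A y = Aᴴ * A := by
  ext i j
  simp only [Matrix.sum_apply, Matrix.mul_apply, Matrix.conjTranspose_apply]
  rw [← (outputEquiv π).sum_comp, Fintype.sum_prod_type]
  rfl

end Output

theorem eq_zero_of_sum_posSemidef_eq_zero {a I : Type} [Fintype a] [Fintype I]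
    {G : I → Op a} (hG : ∀ l, (G l).PosSemidef) (h : ∑ l, G l = 0) (l : I) : G l = 0 := by
  have htr : ∑ l, (G l).trace = 0 := by rw [← Matrix.trace_sum, h, Matrix.trace_zero]
  exact (hG l).trace_eq_zero_iff.1 <|
    (Finset.sum_eq_zero_iff_of_nonneg fun l _ => (hG l).trace_nonneg).1 htr l (Finset.mem_univ l)

/-- If a circuit implements the unitary measurement of `U`, the POVM of its branches is composable
from the POVM of the instrument: the final Kraus operators are multiples of those of the
instrument, so beyond the outcome `k` the record of a branch is random with a distribution
independent of the input. -/
theorem Unravelling.composableFrom_assocPOVM {m n nR nOut d : ℕ} {K' H : Type} [Fintype H]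
    {U : Matrix (Bits (Fin nR) × Bits (Fin nOut)) (Bits (Fin n)) ℂ}
    (hU : Uᴴ * U = 1) (hU' : U * Uᴴ = 1)
    {Ξ : K' → Op (Bits (Fin n)) →ₗ[ℂ] Op (Sys m (∅ : Finset (Fin n)))}
    {B : H → Matrix (Bits (Fin m)) (Bits (Fin n)) ℂ} {κ : H → K'} (hΞ : Unravelling ∅ Ξ B κ)
    (ι : Bits (Fin nR) ↪ K') (π : Fin m ≃ Fin d ⊕ Fin nOut)
    (hΛ : ∀ k, unitaryMeasurement U k = outputTrace π ∘ₗ Ξ (ι k)) :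
    ComposableFrom (branchPOVM ∅ B) (assocPOVM (unitaryMeasurement U)) := by
  classical
  set P : Bits (Fin nR) → Op (Bits (Fin n)) := assocPOVM (unitaryMeasurement U)
  have hP : ∀ k, P k = (outcomeOp U k)ᴴ * outcomeOp U k := fun k =>
    assocPOVM_of_eq_conj (unitaryMeasurement_eq_conj U k)
  have hP0 : ∀ k, P k ≠ 0 := fun k h => outcomeOp_ne_zero hU' k <|
    Matrix.conjTranspose_mul_self_eq_zero.1 ((hP k).symm.trans h)
  -- The Kraus operators contributing to the outcome `k`, extended by zero to all branches.
  set L : Bits (Fin nR) → H × Bits (Fin d) → Matrix (Bits (Fin nOut)) (Bits (Fin n)) ℂ :=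
    fun k l => if κ l.1 = ι k then outputOp π (liftOp ∅ (B l.1)) l.2 else 0 with hLdef
  have hconj : ∀ k, ∑ l, conj (L k l) = conj (outcomeOp U k) := by
    intro k
    rw [← unitaryMeasurement_eq_conj, hΛ, hΞ.eq_sum, Fintype.sum_prod_type]
    ext1 ρ
    simp only [LinearMap.comp_apply, LinearMap.sum_apply, map_sum]
    refine Finset.sum_congr rfl fun h _ => ?_
    by_cases hk : κ h = ι k
    · simp only [hLdef, hk, if_true]
      rw [← LinearMap.comp_apply, outputTrace_comp_conj, LinearMap.sum_apply]
    · simp [hLdef, hk, conj]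
  have hL : ∀ k h, ∑ y, (L k (h, y))ᴴ * L k (h, y) = if κ h = ι k then branchPOVM ∅ B h else 0 := by
    intro k h
    by_cases hk : κ h = ι k
    · simp only [hLdef, hk, if_true, sum_outputOp, branchPOVM]
    · simp [hLdef, hk]
  have hsum : ∀ k, ∑ h, (if κ h = ι k then branchPOVM ∅ B h else 0) = P k := by
    intro k
    rw [hP, ← sum_conjTranspose_mul_self_of_sum_conj_eq (hconj k), Fintype.sum_prod_type]
    simp only [hL]
  choose c hc using fun k => exists_smul_of_sum_conj_eq (hconj k) (outcomeOp_ne_zero hU' k)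
  set ν : H → Bits (Fin nR) → ℝ := fun h k => ∑ y, Complex.normSq (c k (h, y)) with hν
  have hνP : ∀ h k, (ν h k : ℂ) • P k = if κ h = ι k then branchPOVM ∅ B h else 0 := by
    intro h k
    rw [← hL, hν, Complex.ofReal_sum, Finset.sum_smul]
    refine Finset.sum_congr rfl fun y _ => ?_
    rw [hc, hP, Matrix.conjTranspose_smul, Matrix.smul_mul, Matrix.mul_smul, smul_smul,
      Complex.normSq_eq_conj_mul_self]
    rfl
  -- Branches that end with a classical value other than the outcomes of the instrument do not
  -- occur, since the outcomes of the instrument exhaust the total probability.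
  have hzero : ∀ h, (∀ k, κ h ≠ ι k) → branchPOVM ∅ B h = 0 := by
    have h0 : ∑ h, (if ∀ k, κ h ≠ ι k then branchPOVM ∅ B h else 0) = 0 := by
      have h1 : ∀ h, branchPOVM ∅ B h = (if ∀ k, κ h ≠ ι k then branchPOVM ∅ B h else 0) +
          ∑ k, if κ h = ι k then branchPOVM ∅ B h else 0 := by
        intro h
        by_cases hk : ∀ k, κ h ≠ ι k
        · simp [hk]
        · rw [if_neg hk]
          push Not at hk
          obtain ⟨k, hk⟩ := hk
          simp [hk]
      have h2 := hΞ.sum_eq_one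
      rw [Finset.sum_congr rfl fun h _ => h1 h, Finset.sum_add_distrib,
        Finset.sum_comm (s := Finset.univ (α := H))] at h2
      simp only [hsum, hP, sum_outcomeOp hU] at h2
      simpa using h2
    intro h hh
    have := eq_zero_of_sum_posSemidef_eq_zero (fun h => ?_) h0 h
    · rwa [if_pos hh] at this
    · split_ifs
      · exact hΞ.isPOVM.posSemidef h
      · exact Matrix.PosSemidef.zero
  refine ⟨ν, fun h k => Finset.sum_nonneg fun y _ => Complex.normSq_nonneg _, fun k => ?_,
    fun h => ?_⟩
  · have h1 : ((∑ h, ν h k : ℝ) : ℂ) • P k = (1 : ℂ) • P k := by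
      rw [Complex.ofReal_sum, Finset.sum_smul, one_smul]
      simp only [hνP, hsum]
    exact_mod_cast smul_left_injective ℂ (hP0 k) h1
  · simp only [hνP]
    by_cases hk : ∃ k, κ h = ι k
    · obtain ⟨k, hk⟩ := hk
      simp [hk]
    · push Not at hk
      simp [hk, hzero h hk]

theorem IsImplementable.hasReductionChain {m n nR nOut T : ℕ}
    {U : Matrix (Bits (Fin nR) × Bits (Fin nOut)) (Bits (Fin n)) ℂ}
    (hU : Uᴴ * U = 1) (hU' : U * Uᴴ = 1) (hT : m + T ≤ n)
    (h : IsImplementable m (unitaryMeasurement U)) :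
    HasReductionChain (unitaryMeasurement U) T := by
  obtain ⟨K', _, Ξ, ι, d, π, hΞ, hΛ⟩ := h
  obtain ⟨H, _, B, κ, hB, hch⟩ := hΞ.exists_unravelling
  obtain ⟨E, A, h1, h2, h3, h4, h5, -⟩ :=
    (hch T (by simp; omega)).trans (hB.composableFrom_assocPOVM hU hU' ι π hΛ)
  refine ⟨fun t => (E t).1, fun t => (E t).2, A, h1, h2, h3, h4, fun t k => (h5 t k).trans ?_⟩
  refine Nat.pow_le_pow_right two_pos ?_
  have := t.2
  rw [Finset.card_empty]
  omega

end QubitReduction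

end

theorem mainTheorem2 {nIn nR nOut : ℕ}
    (U : Matrix (QubitReduction.Bits (Fin nR) × QubitReduction.Bits (Fin nOut))
      (QubitReduction.Bits (Fin nIn)) ℂ)
    (hU : Uᴴ * U = 1) (hU' : U * Uᴴ = 1) :
    (∀ T ≤ nIn,
      QubitReduction.IsImplementable (nIn - T) (QubitReduction.unitaryMeasurement U) →
        QubitReduction.HasReductionChain (QubitReduction.unitaryMeasurement U) T) ∧
    (∀ T ≤ nIn,
      ¬ QubitReduction.HasReductionChain (QubitReduction.unitaryMeasurement U) T →
        ∀ m, QubitReduction.IsImplementable m (QubitReduction.unitaryMeasurement U) →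
          nIn - T < m) := by
  refine ⟨fun T hT h => h.hasReductionChain hU hU' (by omega), fun T hT hno m h => ?_⟩
  by_contra hm
  exact hno (h.hasReductionChain hU hU' (by omega))
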